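/- Let $(X,d)$ be a non-compact proper metric space which is Gromov hyperbolic, i.e. for some $\delta\ge 0$ the Gromov products $(x|y)_o=\frac12[d(o,x)+d(o,y)-d(x,y)]$ satisfy $(x|z)_o\ge\min\{(x|y)_o,(y|z)_o\}-\delta$ for all $x,y,z,o\in X$ ($X$ need not be geodesic). Let $\partial X$ be its hyperbolic boundary, with its Borel $\sigma$-algebra, and for $\omega\in\partial X$, $x,y\in X$ put $$\beta_\omega(x,y)=\limsup_{z\to\omega}\,[d(y,z)-d(x,z)].$$ Let $G$ be a discrete group of isometries of $X$ (with identity element $e$), and let $\lambda=\{\lambda_x\}_{x\in X}$ be a $G$-invariant quasi-conformal stream of dimension $D>0$ on $\partial X$, i.e. a family of pairwise equivalent finite Borel measures such that $\lambda_{gx}=g\lambda_x$ for all $g\in G$, $x\in X$, and such that, for some constant $C>0$ and all $x,y\in X$, $$\left|\log\frac{d\lambda_x}{d\lambda_y}(\omega)-D\beta_\omega(x,y)\right|\le C\quad\text{for a.e. }\omega\in\partial X .$$ Assume that the measures $\lambda_x$ are purely non-atomic. Fix $o\in X$ and let $$\Lambda^{hb}_G=\{\omega\in\partial X:\ \text{for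 some } p\in X \text{ the horoball } \{x\in X:\beta_\omega(p,x)\le 0\}\text{ contains infinitely many points of the orbit } Go\}$$ be the big horospheric limit set. Then $\Lambda^{hb}_G$ coincides, up to a $\lambda$-null set, with the divergence set of the Poincaré–Busemann series $$\Big\{\omega\in\partial X:\ \sum_{g\in G}e^{D\beta_\omega(go,o)}=\infty\Big\}.$$ If, moreover, the action of $G$ on $\partial X$ is free mod $0$ (for every $g\in G\setminus\{e\}$ one has $g\omega\ne\omega$ for $\lambda$-a.e. $\omega$), then the boundary action has a conservative part, and it coincides up to a $\lambda$-null set with both of these sets. Here a conservative part is a $G$-invariant Borel set $E\subset\partial X$ such that - for every Borel set $A\subset E$ and a.e. $\omega\in A$ there is $g\in G\setminus\{e\}$ with $g\omega\in A$ (the action on $E$ is conservative), and - up to a null set, $\partial X\setminus E$ is the union of the translates $gA$, $g\in G$, of a Borel set $A\subset\partial X\setminus E$ whose translates are pairwise disjoint (the action on the complement is completely dissipative). -/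

import Mathlib

open Filter Topology MeasureTheory Set
open scoped ENNReal Pointwise

noncomputable section

/-! ## Gromov hyperbolic spaces and their boundary -/

/-- The Gromov product `(x|y)_o`. -/
def gromovProduct {X : Type*} [MetricSpace X] (o x y : X) : ℝ :=
  (dist o x + dist o y - dist x y) / 2

/-- The `δ`-ultrametric inequality for the Gromov product, for some `δ ≥ 0`.
The space is not required to be geodesic. -/
class IsGromovHyperbolic (X : Type*) [MetricSpace X] : Prop where
  exists_delta : ∃ δ : ℝ, 0 ≤ δ ∧ ∀ x y z o : X,
    min (gromovProduct o x y) (gromovProduct o y z) - δ ≤ gromovProduct o x z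

/-- Sequences converging to infinity: `(x_i|x_j)_o → ∞` as `i, j → ∞`, for every base point. -/
def GromovSeq (X : Type*) [MetricSpace X] : Type _ :=
  {x : ℕ → X // ∀ o : X,
    Tendsto (fun p : ℕ × ℕ => gromovProduct o (x p.1) (x p.2)) atTop atTop}

/-- Two sequences converging to infinity are equivalent if `(x_i|y_j)_o → ∞` as `i, j → ∞`. -/
instance gromovSetoid (X : Type*) [MetricSpace X] [IsGromovHyperbolic X] :
    Setoid (GromovSeq X) where
  r x y := ∀ o : X,
    Tendsto (fun p : ℕ × ℕ => gromovProduct o (x.1 p.1) (y.1 p.2)) atTop atTop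
  iseqv :=
    { refl := fun x => x.2
      symm := by
        intro x y h o
        have h1 : Tendsto (Prod.swap : ℕ × ℕ → ℕ × ℕ) atTop atTop := by
          rw [← prod_atTop_atTop_eq]
          exact tendsto_snd.prodMk tendsto_fst
        refine ((h o).comp h1).congr fun p => ?_
        simp only [Function.comp, Prod.fst_swap, Prod.snd_swap, gromovProduct]
        rw [dist_comm (x.1 p.2) (y.1 p.1)]
        ring
      trans := by
        intro x y z h1 h2 o
        obtain ⟨δ, -, hδ⟩ := IsGromovHyperbolic.exists_delta (X := X)
        refine tendsto_atTop.2 fun R => ?_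
        obtain ⟨a, ha⟩ := eventually_atTop.1 ((tendsto_atTop.1 (h1 o)) (R + δ))
        obtain ⟨b, hb⟩ := eventually_atTop.1 ((tendsto_atTop.1 (h2 o)) (R + δ))
        refine eventually_atTop.2 ⟨(a.1, b.2), fun p hp => ?_⟩
        have e1 := ha (p.1, max a.2 b.1) ⟨hp.1, le_max_left _ _⟩
        have e2 := hb (max a.2 b.1, p.2) ⟨le_max_right _ _, hp.2⟩
        have e3 := hδ (x.1 p.1) (y.1 (max a.2 b.1)) (z.1 p.2) o
        have e4 := le_min e1 e2
        simp only at e4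
        linarith }

/-- The hyperbolic boundary `∂X`. -/
def GromovBoundary (X : Type*) [MetricSpace X] [IsGromovHyperbolic X] : Type _ :=
  Quotient (gromovSetoid X)

/-- The boundary point to which a sequence converges. -/
def GromovSeq.limit {X : Type*} [MetricSpace X] [IsGromovHyperbolic X] (x : GromovSeq X) :
    GromovBoundary X :=
  Quotient.mk (gromovSetoid X) x

/-- The Gromov product `(z|ω)_o` of a point of the space and a boundary point. -/
def gromovProductPt {X : Type*} [MetricSpace X] [IsGromovHyperbolic X]
    (o z : X) (ω : GromovBoundary X) : EReal :=
  ⨆ (y : GromovSeq X) (_ : y.limit = ω),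
    liminf (fun n : ℕ => ((gromovProduct o z (y.1 n) : ℝ) : EReal)) atTop

/-- The Gromov product `(ω|ω')_o` of two boundary points. -/
def gromovProductBdry {X : Type*} [MetricSpace X] [IsGromovHyperbolic X]
    (o : X) (ω ω' : GromovBoundary X) : EReal :=
  ⨆ (x : GromovSeq X) (_ : x.limit = ω) (y : GromovSeq X) (_ : y.limit = ω'),
    liminf (fun p : ℕ × ℕ => ((gromovProduct o (x.1 p.1) (y.1 p.2) : ℝ) : EReal)) atTop

lemma gromovProduct_le_add_dist {X : Type*} [MetricSpace X] (o p x y : X) :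
    gromovProduct o x y ≤ gromovProduct p x y + dist o p := by
  unfold gromovProduct
  linarith [dist_triangle o p x, dist_triangle o p y]

/-- The topology of the boundary: the sets `{ω' | R < (ω|ω')_o}`, `R ∈ ℝ`, form a basis of
neighbourhoods of `ω`. Different base points give the same topology. -/
instance gromovBoundaryTopology (X : Type*) [MetricSpace X] [IsGromovHyperbolic X] :
    TopologicalSpace (GromovBoundary X) where
  IsOpen U := ∀ ω ∈ U, ∀ o : X, ∃ R : ℝ, {ω' | (R : EReal) < gromovProductBdry o ω ω'} ⊆ U
  isOpen_univ := fun _ _ _ => ⟨0, subset_univ _⟩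
  isOpen_inter := by
    intro U V hU hV ω hω o
    obtain ⟨R, hR⟩ := hU ω hω.1 o
    obtain ⟨S, hS⟩ := hV ω hω.2 o
    refine ⟨max R S, fun ω' h => ⟨hR ?_, hS ?_⟩⟩
    · exact lt_of_le_of_lt (EReal.coe_le_coe_iff.2 (le_max_left R S)) h
    · exact lt_of_le_of_lt (EReal.coe_le_coe_iff.2 (le_max_right R S)) h
  isOpen_sUnion := by
    intro 𝒮 h ω hω o
    obtain ⟨U, hU, hωU⟩ := hω
    obtain ⟨R, hR⟩ := h U hU ω hωU o
    exact ⟨R, hR.trans (subset_sUnion_of_mem hU)⟩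

/-- The Borel `σ`-algebra of the boundary. -/
instance gromovBoundaryMeasurableSpace (X : Type*) [MetricSpace X] [IsGromovHyperbolic X] :
    MeasurableSpace (GromovBoundary X) :=
  borel (GromovBoundary X)

instance gromovBoundaryBorelSpace (X : Type*) [MetricSpace X] [IsGromovHyperbolic X] :
    BorelSpace (GromovBoundary X) :=
  ⟨rfl⟩

/-! ## The boundary action -/

lemma gromovProduct_isometryEquiv {X : Type*} [MetricSpace X] (g : X ≃ᵢ X) (o x y : X) :
    gromovProduct o (g x) (g y) = gromovProduct (g.symm o) x y := by
  have h : ∀ z, dist o (g z) = dist (g.symm o) z := fun z => by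
    rw [← g.isometry.dist_eq (g.symm o) z, g.apply_symm_apply]
  simp only [gromovProduct, h, g.isometry.dist_eq]

/-- The image of a sequence converging to infinity under an isometry. -/
def GromovSeq.map {X : Type*} [MetricSpace X] (g : X ≃ᵢ X) (x : GromovSeq X) : GromovSeq X :=
  ⟨fun n => g (x.1 n), fun o => by
    simpa only [gromovProduct_isometryEquiv] using x.2 (g.symm o)⟩

/-- The action of isometries on the boundary: `g (lim x_n) = lim g x_n`. -/
instance gromovBoundaryAction (X : Type*) [MetricSpace X] [IsGromovHyperbolic X] :
    MulAction (X ≃ᵢ X) (GromovBoundary X) where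
  smul g := Quotient.map (GromovSeq.map g) (by
    intro x y h o
    simpa only [GromovSeq.map, gromovProduct_isometryEquiv] using h (g.symm o))
  one_smul := by
    rintro ⟨x⟩
    rfl
  mul_smul := by
    rintro g h ⟨x⟩
    rfl

/-- A group of isometries is discrete if it is discrete in the topology of pointwise convergence
(on a group of isometries this is the compact-open topology). -/
def IsDiscreteIsometryGroup {X : Type*} [MetricSpace X] (G : Subgroup (X ≃ᵢ X)) : Prop :=
  @DiscreteTopology G
    (TopologicalSpace.induced (fun (g : G) (x : X) => (g : X ≃ᵢ X) x) inferInstance)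

/-! ## Busemann quasi-cocycles and the big horospheric limit set -/

/-- The filter of convergence `z → ω` of points of the space to a boundary point, with basis
`{z | R < (z|ω)_o}`, `R ∈ ℝ`. Different base points `o` give the same filter. -/
def toBoundary {X : Type*} [MetricSpace X] [IsGromovHyperbolic X] (ω : GromovBoundary X) :
    Filter X :=
  ⨅ (o : X) (R : ℝ), 𝓟 {z | (R : EReal) < gromovProductPt o z ω}

/-- The Busemann quasi-cocycle `β_ω(x, y) = limsup_{z → ω} [d(y, z) - d(x, z)]`
(the function under the limit is bounded by `d(x, y)`). -/
def busemann {X : Type*} [MetricSpace X] [IsGromovHyperbolic X]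
    (ω : GromovBoundary X) (x y : X) : ℝ :=
  limsup (fun z => dist y z - dist x z) (toBoundary ω)

/-- The horoball centered at `ω` and passing through `p`. -/
def horoball {X : Type*} [MetricSpace X] [IsGromovHyperbolic X]
    (ω : GromovBoundary X) (p : X) : Set X :=
  {x | busemann ω p x ≤ 0}

/-- The boundary points `ω` such that a certain horoball centered at `ω` contains infinitely many
points of the orbit `Go`. -/
def bigHorosphericLimitSet {X : Type*} [MetricSpace X] [IsGromovHyperbolic X]
    (G : Subgroup (X ≃ᵢ X)) (o : X) : Set (GromovBoundary X) :=
  {ω | ∃ p : X, (range (fun g : G => (g : X ≃ᵢ X) o) ∩ horoball ω p).Infinite}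

/-- The divergence set of the Poincaré–Busemann series `∑_g exp (D β_ω(go, o))`. -/
def poincareBusemannDivergenceSet {X : Type*} [MetricSpace X] [IsGromovHyperbolic X]
    (G : Subgroup (X ≃ᵢ X)) (D : ℝ) (o : X) : Set (GromovBoundary X) :=
  {ω | ∑' g : G, ENNReal.ofReal (Real.exp (D * busemann ω ((g : X ≃ᵢ X) o) o)) = ∞}

/-! ## Quasi-conformal streams -/

/-- A quasi-conformal stream of dimension `D > 0`: a family of pairwise equivalent finite boundary
measures whose logarithmic Radon–Nikodym derivatives are `D β_ω(x, y)` up to a uniform error. -/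
structure IsQuasiConformalStream {X : Type*} [MetricSpace X] [IsGromovHyperbolic X]
    (D : ℝ) (lam : X → Measure (GromovBoundary X)) : Prop where
  dim_pos : 0 < D
  finite : ∀ x, IsFiniteMeasure (lam x)
  equivalent : ∀ x y, lam x ≪ lam y
  quasiconformal : ∃ C : ℝ, 0 < C ∧ ∀ x y : X, ∀ᵐ ω ∂(lam y),
    |Real.log ((lam x).rnDeriv (lam y) ω).toReal - D * busemann ω x y| ≤ C

/-- Invariance of a stream: `lam (g x) = g (lam x)`. -/
def IsInvariantStream {X : Type*} [MetricSpace X] [IsGromovHyperbolic X]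
    (G : Subgroup (X ≃ᵢ X)) (lam : X → Measure (GromovBoundary X)) : Prop :=
  ∀ (g : G) (x : X), lam ((g : X ≃ᵢ X) x) = (lam x).map (fun ω => g • ω)

/-! ## Hopf decomposition -/

/-- A set `A` is recurrent if almost every point of `A` returns to `A` under
some non-identity element of the group. -/
def IsRecurrentSet (Γ : Type*) {Y : Type*} [Group Γ] [MulAction Γ Y] [MeasurableSpace Y]
    (μ : Measure Y) (A : Set Y) : Prop :=
  ∀ᵐ y ∂μ, y ∈ A → ∃ g : Γ, g ≠ 1 ∧ g • y ∈ A

/-- A wandering set: a measurable set with pairwise disjoint translates. -/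
def IsWanderingSet (Γ : Type*) {Y : Type*} [Group Γ] [MulAction Γ Y] [MeasurableSpace Y]
    (A : Set Y) : Prop :=
  MeasurableSet A ∧ Pairwise fun g h : Γ => Disjoint (g • A) (h • A)

/-- `C` is the conservative part of a Hopf decomposition `Y = C ⊔ Cᶜ`: it is a measurable
invariant set, the restriction of the action to `C` is conservative (every measurable subset is
recurrent), and the restriction to `Cᶜ` is completely dissipative (up to a null set, `Cᶜ` is the
union of the translates of a wandering set). -/
structure IsConservativePart (Γ : Type*) {Y : Type*} [Group Γ] [MulAction Γ Y]
    [MeasurableSpace Y] (μ : Measure Y) (C : Set Y) : Prop where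
  measurableSet : MeasurableSet C
  invariant : ∀ g : Γ, g • C = C
  conservative : ∀ A ⊆ C, MeasurableSet A → IsRecurrentSet Γ μ A
  dissipative : ∃ A ⊆ Cᶜ, IsWanderingSet Γ A ∧ (⋃ g : Γ, g • A) =ᵐ[μ] Cᶜ

/-- The action is free mod 0: every non-identity element moves almost every point. -/
def IsEssentiallyFree (Γ : Type*) {Y : Type*} [Group Γ] [MulAction Γ Y] [MeasurableSpace Y]
    (μ : Measure Y) : Prop :=
  ∀ g : Γ, g ≠ 1 → ∀ᵐ y ∂μ, g • y ≠ y

end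

/-! Quasi-conformality and invariance say that the orbit densities ρ_g = d(gλ_o)/dλ_o equal exp(D
β_ω(go,o)) up to a bounded factor (`IsQuasiConformalStream.exists_ae_orbitDensity`). So the
divergence set is {∑ρ_g = ∞} mod 0, and the rest is mostly about a countable group acting on a
finite measure space.

Two facts carry that part. The integral of ∑ρ_g over A equals the integral of the number of visits
of an orbit to A, so ∑ρ_g is a.e. finite on any set visited a bounded number of times
(`ae_tsum_orbitDensity_ne_top`). By the chain rule, the set where at most n of the ρ_g are ≥ 1 is
visited at most n times (`ae_visitCount_denseCount_le`). Hence, almost surely, ∑ρ_g = ∞ exactly when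
infinitely many ρ_g are ≥ 1.

In that case infinitely many g have β_ω(go,o) ≥ -K for a fixed K. If some k has β_ω(ko,o) far below
-K, the quasi-cocycle identity puts all these go into the horoball through ko. For infinite G such a
k fails to exist for at most one ω, a null set as there are no atoms. Conversely, infinitely many
orbit points in a horoball give infinitely many terms bounded below.

For the Hopf decomposition, translates of a wandering set are visited at most once, so ∑ρ_g < ∞ on
the dissipative part. In the conservative part of a free action a set visited boundedly often is
null (`measure_eq_zero_of_visitCount_le`), so ∑ρ_g = ∞ there. -/

section Boundary

variable {X : Type*} [MetricSpace X]

/-! ### Gromov products of points -/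

lemma gromovProduct_comm (o x y : X) : gromovProduct o x y = gromovProduct o y x := by
  simp only [gromovProduct, dist_comm x y]
  ring

lemma dist_sub_dist_eq_gromovProduct (x y z : X) :
    dist y z - dist x z = dist x y - 2 * gromovProduct x y z := by
  unfold gromovProduct
  ring

lemma gromovProduct_le_dist (x y z : X) : gromovProduct x y z ≤ dist x y := by
  unfold gromovProduct
  linarith [dist_triangle x y z]

lemma gromovProduct_le_add_dist_left (o x x' y : X) :
    gromovProduct o x y ≤ gromovProduct o x' y + dist x x' := by
  unfold gromovProduct
  linarith [dist_triangle o x' x, dist_triangle x' x y, dist_comm x x']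

/-- `δ` is an admissible constant in the definition of hyperbolicity. -/
def IsHyperbolicConst (X : Type*) [MetricSpace X] (δ : ℝ) : Prop :=
  0 ≤ δ ∧ ∀ x y z o : X,
    min (gromovProduct o x y) (gromovProduct o y z) - δ ≤ gromovProduct o x z

lemma IsHyperbolicConst.lt_gromovProduct {δ : ℝ} (h : IsHyperbolicConst X δ) {x y z o : X}
    {R : ℝ} (h1 : R < gromovProduct o x y) (h2 : R < gromovProduct o y z) :
    R - δ < gromovProduct o x z := by
  linarith [h.2 x y z o, lt_min h1 h2]

/-! ### Discreteness implies finitely many orbit returns to balls -/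

lemma IsDiscreteIsometryGroup.exists_dist_lt_imp_eq_one {G : Subgroup (X ≃ᵢ X)}
    (hG : IsDiscreteIsometryGroup G) :
    ∃ (I : Finset X) (ε : ℝ), 0 < ε ∧
      ∀ g : G, (∀ a ∈ I, dist ((g : X ≃ᵢ X) a) a < ε) → g = 1 := by
  have h1 := @isOpen_discrete G (TopologicalSpace.induced _ _) hG {1}
  obtain ⟨U, hU, hU1⟩ := isOpen_induced_iff.1 h1
  have hid : (fun x : X => ((1 : G) : X ≃ᵢ X) x) ∈ U := by
    have : (1 : G) ∈ ({1} : Set G) := rfl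
    rwa [← hU1] at this
  obtain ⟨I, u, hu, hsub⟩ := isOpen_pi_iff.1 hU _ hid
  have hV : IsOpen (univ.pi fun a : I => u a) := isOpen_set_pi finite_univ fun a _ => (hu a a.2).1
  obtain ⟨ε, hε, hball⟩ := Metric.isOpen_iff.1 hV (fun a => (a : X)) fun a _ => (hu a a.2).2
  refine ⟨I, ε, hε, fun g hg => ?_⟩
  have h2 : (fun a : I => (g : X ≃ᵢ X) a) ∈ univ.pi fun a : I => u a :=
    hball ((dist_pi_lt_iff hε).2 fun a => hg a a.2)
  have h3 : g ∈ (fun (g : G) (x : X) => (g : X ≃ᵢ X) x) ⁻¹' U :=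
    hsub fun a ha => h2 ⟨a, ha⟩ (mem_univ _)
  rwa [hU1] at h3

/-- Restricted to the finite set `I` that detects the identity, these g map into a compact product
of balls. Two of them that are `ε`-close on `I` coincide, so a finite cover by balls of radius `ε /
2` bounds their number. -/
lemma IsDiscreteIsometryGroup.finite_dist_le [ProperSpace X] {G : Subgroup (X ≃ᵢ X)}
    (hG : IsDiscreteIsometryGroup G) (o : X) (R : ℝ) :
    {g : G | dist o ((g : X ≃ᵢ X) o) ≤ R}.Finite := by
  obtain ⟨I, ε, hε, h⟩ := hG.exists_dist_lt_imp_eq_one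
  let F : G → I → X := fun g a => (g : X ≃ᵢ X) a
  have hK : IsCompact (univ.pi fun a : I => Metric.closedBall o (R + dist o a)) :=
    isCompact_univ_pi fun a => isCompact_closedBall o _
  obtain ⟨t, ht, hcov⟩ := Metric.totallyBounded_iff.1 hK.totallyBounded (ε / 2) (half_pos hε)
  refine (ht.biUnion (t := fun y => {g : G | F g ∈ Metric.ball y (ε / 2)})
    fun y _ => Set.Subsingleton.finite fun g hg k hk => ?_).subset fun g hg => ?_
  · have hgk : dist (F g) (F k) < ε := by
      have := dist_triangle_right (F g) (F k) y
      have h1 : dist (F g) y < ε / 2 := hg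
      have h2 : dist (F k) y < ε / 2 := hk
      linarith
    have := h (k⁻¹ * g) fun a ha => by
      have h1 := (dist_pi_lt_iff hε).1 hgk ⟨a, ha⟩
      rw [← (k : X ≃ᵢ X).isometry.dist_eq]
      simpa [F] using h1
    exact (inv_mul_eq_one.1 this).symm
  · have : F g ∈ univ.pi fun a : I => Metric.closedBall o (R + dist o a) := fun a _ => by
      rw [Metric.mem_closedBall]
      have h1 := dist_triangle ((g : X ≃ᵢ X) a) ((g : X ≃ᵢ X) o) o
      rw [(g : X ≃ᵢ X).isometry.dist_eq, dist_comm (a : X) o, dist_comm ((g : X ≃ᵢ X) o) o] at h1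
      have h2 : dist o ((g : X ≃ᵢ X) o) ≤ R := hg
      simp only [F]
      linarith
    simpa using hcov this

lemma IsDiscreteIsometryGroup.countable [ProperSpace X] {G : Subgroup (X ≃ᵢ X)}
    (hG : IsDiscreteIsometryGroup G) (o : X) : Countable G := by
  rw [← countable_univ_iff]
  refine (countable_iUnion fun n : ℕ => (hG.finite_dist_le o n).countable).mono fun g _ => ?_
  exact mem_iUnion.2 (exists_nat_ge (dist o ((g : X ≃ᵢ X) o)))

variable [IsGromovHyperbolic X]

lemma exists_isHyperbolicConst (X : Type*) [MetricSpace X] [IsGromovHyperbolic X] :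
    ∃ δ, IsHyperbolicConst X δ :=
  IsGromovHyperbolic.exists_delta

/-! ### Coarse inequalities for Gromov products at infinity -/

namespace GromovBoundary

lemma exists_rep (ω : GromovBoundary X) : ∃ y : GromovSeq X, y.limit = ω :=
  Quotient.exists_rep ω

lemma tendsto_of_limit_eq {x y : GromovSeq X} (h : x.limit = y.limit) (o : X) :
    Tendsto (fun p : ℕ × ℕ => gromovProduct o (x.1 p.1) (y.1 p.2)) atTop atTop :=
  (Quotient.exact h : (gromovSetoid X).r x y) o

lemma tendsto_diag_of_limit_eq {x y : GromovSeq X} (h : x.limit = y.limit) (o : X) :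
    Tendsto (fun n => gromovProduct o (x.1 n) (y.1 n)) atTop atTop :=
  (tendsto_of_limit_eq h o).comp tendsto_atTop_diagonal

variable {δ : ℝ} {o z z' : X} {R : ℝ} {ω ω' ω'' : GromovBoundary X}

/-- The supremum is witnessed by one representative sequence; passing to any other one costs a
single `δ`. This makes the later estimates computable on arbitrary representatives. -/
lemma eventually_lt_of_lt_pt (hδ : IsHyperbolicConst X δ)
    (h : (R : EReal) < gromovProductPt o z ω) {y : GromovSeq X} (hy : y.limit = ω) :
    ∀ᶠ n in atTop, R - δ < gromovProduct o z (y.1 n) := by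
  simp only [gromovProductPt, lt_iSup_iff] at h
  obtain ⟨y', hy', h⟩ := h
  filter_upwards [eventually_lt_of_lt_liminf h,
    (tendsto_diag_of_limit_eq (hy'.trans hy.symm) o).eventually_gt_atTop R] with n h1 h2
  exact hδ.lt_gromovProduct (EReal.coe_lt_coe_iff.1 h1) h2

lemma le_pt_of_eventually {y : GromovSeq X} (hy : y.limit = ω)
    (h : ∀ᶠ n in atTop, R ≤ gromovProduct o z (y.1 n)) : (R : EReal) ≤ gromovProductPt o z ω :=
  le_iSup₂_of_le y hy (le_liminf_of_le (by isBoundedDefault)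
    (h.mono fun _ hn => EReal.coe_le_coe_iff.2 hn))

lemma eventually_lt_of_lt_bdry (hδ : IsHyperbolicConst X δ)
    (h : (R : EReal) < gromovProductBdry o ω ω') {x y : GromovSeq X} (hx : x.limit = ω)
    (hy : y.limit = ω') :
    ∀ᶠ p : ℕ × ℕ in atTop, R - 2 * δ < gromovProduct o (x.1 p.1) (y.1 p.2) := by
  simp only [gromovProductBdry, lt_iSup_iff] at h
  obtain ⟨x', hx', y', hy', h⟩ := h
  have t1 : Tendsto (fun p : ℕ × ℕ => p.1) atTop atTop := by
    rw [← prod_atTop_atTop_eq]; exact tendsto_fst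
  have t2 : Tendsto (fun p : ℕ × ℕ => p.2) atTop atTop := by
    rw [← prod_atTop_atTop_eq]; exact tendsto_snd
  filter_upwards [eventually_lt_of_lt_liminf h,
    t1.eventually ((tendsto_diag_of_limit_eq (hx.trans hx'.symm) o).eventually_gt_atTop R),
    t2.eventually ((tendsto_diag_of_limit_eq (hy'.trans hy.symm) o).eventually_gt_atTop (R - δ))]
    with p h1 h2 h3
  have := hδ.lt_gromovProduct (hδ.lt_gromovProduct h2 (EReal.coe_lt_coe_iff.1 h1)) h3
  linarith

lemma le_bdry_of_eventually {x y : GromovSeq X} (hx : x.limit = ω) (hy : y.limit = ω')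
    (h : ∀ᶠ p : ℕ × ℕ in atTop, R ≤ gromovProduct o (x.1 p.1) (y.1 p.2)) :
    (R : EReal) ≤ gromovProductBdry o ω ω' :=
  le_iSup₂_of_le x hx <| le_iSup₂_of_le y hy <| le_liminf_of_le (by isBoundedDefault)
    (h.mono fun _ hn => EReal.coe_le_coe_iff.2 hn)

lemma lt_gromovProduct_of_lt_pt (hδ : IsHyperbolicConst X δ)
    (h : (R : EReal) < gromovProductPt o z ω) (h' : (R : EReal) < gromovProductPt o z' ω) :
    R - 2 * δ < gromovProduct o z z' := by
  obtain ⟨y, hy⟩ := exists_rep ω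
  obtain ⟨n, h1, h2⟩ :=
    ((eventually_lt_of_lt_pt hδ h hy).and (eventually_lt_of_lt_pt hδ h' hy)).exists
  rw [gromovProduct_comm] at h2
  linarith [hδ.lt_gromovProduct h1 h2]

lemma le_pt_of_lt_bdry (hδ : IsHyperbolicConst X δ)
    (h : (R : EReal) < gromovProductPt o z ω) (h' : (R : EReal) < gromovProductBdry o ω ω') :
    ((R - 3 * δ : ℝ) : EReal) ≤ gromovProductPt o z ω' := by
  obtain ⟨x, hx⟩ := exists_rep ω
  obtain ⟨y, hy⟩ := exists_rep ω'
  refine le_pt_of_eventually hy ?_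
  filter_upwards [eventually_lt_of_lt_pt hδ h hx,
    tendsto_atTop_diagonal.eventually (eventually_lt_of_lt_bdry hδ h' hx hy)] with n h1 h2
  have h3 : R - 2 * δ < gromovProduct o z (x.1 n) := by linarith [hδ.1]
  linarith [hδ.lt_gromovProduct h3 h2]

lemma le_bdry_of_lt_pt (hδ : IsHyperbolicConst X δ)
    (h : (R : EReal) < gromovProductPt o z ω) (h' : (R : EReal) < gromovProductPt o z ω') :
    ((R - 2 * δ : ℝ) : EReal) ≤ gromovProductBdry o ω ω' := by
  obtain ⟨x, hx⟩ := exists_rep ω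
  obtain ⟨y, hy⟩ := exists_rep ω'
  refine le_bdry_of_eventually hx hy ?_
  have ev := (eventually_lt_of_lt_pt hδ h hx).prod_mk (eventually_lt_of_lt_pt hδ h' hy)
  rw [prod_atTop_atTop_eq] at ev
  filter_upwards [ev] with p hp
  have h1 := hp.1
  rw [gromovProduct_comm] at h1
  linarith [hδ.lt_gromovProduct h1 hp.2]

lemma le_bdry_trans (hδ : IsHyperbolicConst X δ)
    (h : (R : EReal) < gromovProductBdry o ω ω') (h' : (R : EReal) < gromovProductBdry o ω' ω'') :
    ((R - 3 * δ : ℝ) : EReal) ≤ gromovProductBdry o ω ω'' := by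
  obtain ⟨x, hx⟩ := exists_rep ω
  obtain ⟨y, hy⟩ := exists_rep ω'
  obtain ⟨z, hz⟩ := exists_rep ω''
  refine le_bdry_of_eventually hx hz ?_
  obtain ⟨a, ha⟩ := eventually_atTop.1 (eventually_lt_of_lt_bdry hδ h hx hy)
  obtain ⟨b, hb⟩ := eventually_atTop.1 (eventually_lt_of_lt_bdry hδ h' hy hz)
  refine eventually_atTop.2 ⟨(a.1, b.2), fun p hp => ?_⟩
  have e1 := ha (p.1, max a.2 b.1) ⟨hp.1, le_max_left _ _⟩
  have e2 := hb (max a.2 b.1, p.2) ⟨le_max_right _ _, hp.2⟩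
  linarith [hδ.lt_gromovProduct e1 e2]

lemma le_bdry_change_base (hδ : IsHyperbolicConst X δ) {p : X}
    (h : ((R + dist o p + 2 * δ : ℝ) : EReal) < gromovProductBdry o ω ω') :
    (R : EReal) ≤ gromovProductBdry p ω ω' := by
  obtain ⟨x, hx⟩ := exists_rep ω
  obtain ⟨y, hy⟩ := exists_rep ω'
  refine le_bdry_of_eventually hx hy ?_
  filter_upwards [eventually_lt_of_lt_bdry hδ h hx hy] with n hn
  linarith [gromovProduct_le_add_dist o p (x.1 n.1) (y.1 n.2)]

lemma lt_bdry_self (o : X) (R : ℝ) (ω : GromovBoundary X) :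
    (R : EReal) < gromovProductBdry o ω ω := by
  obtain ⟨x, hx⟩ := exists_rep ω
  refine lt_of_lt_of_le (EReal.coe_lt_coe_iff.2 (lt_add_one R)) (le_bdry_of_eventually hx hx ?_)
  exact (x.2 o).eventually_ge_atTop (R + 1)

lemma eq_of_lt_bdry (h : ∀ R : ℝ, (R : EReal) < gromovProductBdry o ω ω') : ω = ω' := by
  obtain ⟨δ, hδ⟩ := exists_isHyperbolicConst X
  obtain ⟨x, rfl⟩ := exists_rep ω
  obtain ⟨y, rfl⟩ := exists_rep ω'
  refine Quotient.sound (s := gromovSetoid X) fun p => tendsto_atTop.2 fun R => ?_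
  filter_upwards [eventually_lt_of_lt_bdry hδ (h (R + dist o p + 2 * δ)) rfl rfl] with n hn
  linarith [gromovProduct_le_add_dist o p (x.1 n.1) (y.1 n.2)]

lemma eventually_lt_pt {y : GromovSeq X} (hy : y.limit = ω) (o : X) (R : ℝ) :
    ∀ᶠ n in atTop, (R : EReal) < gromovProductPt o (y.1 n) ω := by
  obtain ⟨a, ha⟩ := eventually_atTop.1 ((y.2 o).eventually_ge_atTop (R + 1))
  filter_upwards [eventually_ge_atTop a.1] with n hn
  refine lt_of_lt_of_le (EReal.coe_lt_coe_iff.2 (lt_add_one R)) (le_pt_of_eventually hy ?_)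
  filter_upwards [eventually_ge_atTop a.2] with m hm using ha (n, m) ⟨hn, hm⟩

lemma le_pt_of_dist (hδ : IsHyperbolicConst X δ)
    (h : ((R + dist z z' + δ : ℝ) : EReal) < gromovProductPt o z ω) :
    (R : EReal) ≤ gromovProductPt o z' ω := by
  obtain ⟨x, hx⟩ := exists_rep ω
  refine le_pt_of_eventually hx ?_
  filter_upwards [eventually_lt_of_lt_pt hδ h hx] with n hn
  linarith [gromovProduct_le_add_dist_left o z z' (x.1 n)]

/-! ### The topology of the boundary -/

/-- The basic sets need not be open, but the points having some basic set inside `W` form an open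
set, by the coarse transitivity `le_bdry_trans`. -/
lemma mem_interior_of_lt (o : X) (W : Set (GromovBoundary X))
    (h : {ω' | (R : EReal) < gromovProductBdry o ω ω'} ⊆ W) : ω ∈ interior W := by
  obtain ⟨δ, hδ⟩ := exists_isHyperbolicConst X
  refine mem_interior.2 ⟨{ω' | ∃ S : ℝ, {ω'' | (S : EReal) < gromovProductBdry o ω' ω''} ⊆ W},
    fun ω' ⟨S, hS⟩ => hS (lt_bdry_self o S ω'), ?_, ⟨R, h⟩⟩
  rintro ω' ⟨S, hS⟩ p
  set T : ℝ := S + 1 + 3 * δ with hT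
  -- Openness is tested at every base point: `dist p o + 2 * δ` pays for moving from `p` to `o`, and
  -- the `3 * δ` in `T` for transitivity.
  refine ⟨T + 1 + dist p o + 2 * δ, fun ω'' h'' => ⟨T, fun ω₃ h₃ => hS ?_⟩⟩
  have h1 : (T : EReal) < gromovProductBdry o ω' ω'' :=
    lt_of_lt_of_le (EReal.coe_lt_coe_iff.2 (lt_add_one T)) (le_bdry_change_base hδ h'')
  refine lt_of_lt_of_le (EReal.coe_lt_coe_iff.2 ?_) (le_bdry_trans hδ h1 h₃)
  linarith

lemma gromovProductBdry_smul_le (g : X ≃ᵢ X) (o : X) (ω ω' : GromovBoundary X) :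
    gromovProductBdry (g.symm o) ω ω' ≤ gromovProductBdry o (g • ω) (g • ω') := by
  refine iSup₂_le fun x hx => iSup₂_le fun y hy => ?_
  refine le_iSup₂_of_le (x.map g) (by rw [← hx]; rfl) <|
    le_iSup₂_of_le (y.map g) (by rw [← hy]; rfl) ?_
  simp only [GromovSeq.map, gromovProduct_isometryEquiv, le_refl]

lemma continuous_smul (g : X ≃ᵢ X) : Continuous fun ω : GromovBoundary X => g • ω := by
  refine ⟨fun U hU ω hω p => ?_⟩
  obtain ⟨R, hR⟩ := hU _ hω (g p)
  refine ⟨R, fun ω' h => hR ?_⟩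
  have h1 := gromovProductBdry_smul_le g (g p) ω ω'
  rw [g.symm_apply_apply] at h1
  exact lt_of_lt_of_le (by exact h) h1

instance countablySeparated [ProperSpace X] :
    MeasurableSpace.CountablySeparated (GromovBoundary X) := by
  obtain ⟨δ, hδ⟩ := exists_isHyperbolicConst X
  rcases isEmpty_or_nonempty X with hX | ⟨⟨o⟩⟩
  · have : IsEmpty (GromovBoundary X) :=
      ⟨fun ω => (exists_rep ω).elim fun y _ => hX.elim (y.1 0)⟩
    exact ⟨⟨∅, countable_empty, by simp, fun ω => isEmptyElim ω⟩⟩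
  obtain ⟨s, hsc, hsd⟩ := TopologicalSpace.exists_countable_dense X
  -- Separating family: interiors of shadows cast from `o` by the points of a countable dense set,
  -- with rational depth. Two boundary points sharing all deep shadows have infinite Gromov product.
  refine ⟨⟨(fun q : X × ℚ => interior {ω | (((q.2 : ℚ) : ℝ) : EReal) < gromovProductPt o q.1 ω}) ''
    (s ×ˢ univ), (hsc.prod (to_countable _)).image _, ?_, ?_⟩⟩
  · rintro _ ⟨q, -, rfl⟩
    exact isOpen_interior.measurableSet
  · intro ω _ ω' _ h
    refine eq_of_lt_bdry (o := o) fun R => ?_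
    obtain ⟨y, hy⟩ := exists_rep ω
    obtain ⟨q, hq, hq'⟩ := exists_rat_btwn (lt_add_one (R + 2 * δ))
    set T : ℝ := q + 3 * δ + 1 with hT
    -- One unit pays for replacing `y.1 n` by a point of the dense set at distance less than 1, the
    -- other for strictness.
    obtain ⟨n, hn⟩ := (eventually_lt_pt hy o (T + 1 + 1 + δ)).exists
    obtain ⟨z, hz, hzd⟩ := hsd.exists_dist_lt (y.1 n) one_pos
    have h1 : (T : EReal) < gromovProductPt o z ω := by
      refine lt_of_lt_of_le (EReal.coe_lt_coe_iff.2 (lt_add_one T)) (le_pt_of_dist (z := y.1 n) hδ ?_)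
      refine lt_of_le_of_lt (EReal.coe_le_coe_iff.2 ?_) hn
      linarith
    have h2 : ω ∈ interior {ω | (((q : ℚ) : ℝ) : EReal) < gromovProductPt o z ω} := by
      refine mem_interior_of_lt (R := T) o _ fun ω₁ h₁ => ?_
      refine lt_of_lt_of_le (EReal.coe_lt_coe_iff.2 ?_) (le_pt_of_lt_bdry hδ h1 h₁)
      linarith
    have h3 := mem_ofPred_eq ▸ interior_subset ((h _ ⟨(z, q), ⟨hz, mem_univ _⟩, rfl⟩).1 h2)
    have h4 := mem_ofPred_eq ▸ interior_subset h2
    refine lt_of_lt_of_le (EReal.coe_lt_coe_iff.2 ?_) (le_bdry_of_lt_pt hδ h4 h3)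
    linarith

end GromovBoundary

/-! ### Busemann functions -/

lemma eventually_toBoundary (ω : GromovBoundary X) (o : X) (R : ℝ) :
    ∀ᶠ z in toBoundary ω, (R : EReal) < gromovProductPt o z ω :=
  mem_iInf_of_mem o (mem_iInf_of_mem R (mem_principal_self _))

lemma GromovSeq.tendsto_toBoundary {y : GromovSeq X} {ω : GromovBoundary X} (hy : y.limit = ω) :
    Tendsto y.1 atTop (toBoundary ω) :=
  tendsto_iInf.2 fun o => tendsto_iInf.2 fun R => tendsto_principal.2
    (GromovBoundary.eventually_lt_pt hy o R)

instance toBoundary_neBot (ω : GromovBoundary X) : (toBoundary ω).NeBot := by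
  obtain ⟨y, hy⟩ := GromovBoundary.exists_rep ω
  exact (GromovSeq.tendsto_toBoundary hy).neBot

/-- The function under the limsup is d(x,y) - 2(y|z)_x. Once (z|z')_x exceeds d(x,y) ≥ (y|z)_x,
hyperbolicity bounds its oscillation by `2 * δ`, so the limsup is a limit up to that error. -/
lemma abs_sub_busemann_le {δ : ℝ} (hδ : IsHyperbolicConst X δ) (ω : GromovBoundary X) (x y : X) :
    ∀ᶠ z in toBoundary ω, |dist y z - dist x z - busemann ω x y| ≤ 2 * δ := by
  have key : ∀ z z', ((dist x y + 2 * δ : ℝ) : EReal) < gromovProductPt x z ω →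
      ((dist x y + 2 * δ : ℝ) : EReal) < gromovProductPt x z' ω →
      dist y z' - dist x z' ≤ dist y z - dist x z + 2 * δ := by
    intro z z' h h'
    rw [dist_sub_dist_eq_gromovProduct, dist_sub_dist_eq_gromovProduct]
    have h1 := GromovBoundary.lt_gromovProduct_of_lt_pt hδ h h'
    have h2 := hδ.2 y z z' x
    rw [min_eq_left (by linarith [gromovProduct_le_dist x y z])] at h2
    linarith
  have hb : ∀ z, |dist y z - dist x z| ≤ dist x y := fun z => by
    rw [dist_comm x y]; exact abs_dist_sub_le y x z
  have ev := eventually_toBoundary ω x (dist x y + 2 * δ)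
  filter_upwards [ev] with z hz
  have hco : IsCoboundedUnder (· ≤ ·) (toBoundary ω) fun z => dist y z - dist x z :=
    (isBoundedUnder_of ⟨-dist x y, fun z => (abs_le.1 (hb z)).1⟩ :
      IsBoundedUnder (· ≥ ·) (toBoundary ω) _).isCoboundedUnder_le
  have hbd : IsBoundedUnder (· ≤ ·) (toBoundary ω) fun z => dist y z - dist x z :=
    isBoundedUnder_of ⟨dist x y, fun z => (abs_le.1 (hb z)).2⟩
  have h1 : busemann ω x y ≤ dist y z - dist x z + 2 * δ :=
    limsup_le_of_le hco (ev.mono fun z' hz' => key z z' hz hz')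
  have h2 : dist y z - dist x z - 2 * δ ≤ busemann ω x y :=
    le_limsup_of_frequently_le
      (ev.mono fun z' hz' => by linarith [key z' z hz' hz]).frequently hbd
  exact abs_le.2 ⟨by linarith, by linarith⟩

/-- The differences of distances to one common point near `ω` form an exact cocycle; each of the
three approximations costs `2 * δ`. -/
lemma abs_busemann_add_sub_le {δ : ℝ} (hδ : IsHyperbolicConst X δ) (ω : GromovBoundary X)
    (x y z : X) : |busemann ω x y + busemann ω y z - busemann ω x z| ≤ 6 * δ := by
  obtain ⟨w, ⟨h1, h2⟩, h3⟩ := (((abs_sub_busemann_le hδ ω x y).and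
    (abs_sub_busemann_le hδ ω y z)).and (abs_sub_busemann_le hδ ω x z)).exists
  rw [abs_le] at *
  constructor <;> linarith [h1.1, h1.2, h2.1, h2.2, h3.1, h3.2]

lemma lt_gromovProductPt_of_busemann {δ : ℝ} (hδ : IsHyperbolicConst X δ) {ω : GromovBoundary X}
    {o p : X} {R : ℝ} (h : 2 * R + 4 * δ + 2 < busemann ω p o + dist o p) :
    (R : EReal) < gromovProductPt o p ω := by
  obtain ⟨y, hy⟩ := GromovBoundary.exists_rep ω
  have ht := GromovSeq.tendsto_toBoundary hy
  refine lt_of_lt_of_le (EReal.coe_lt_coe_iff.2 (lt_add_one R))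
    (GromovBoundary.le_pt_of_eventually hy ?_)
  filter_upwards [ht.eventually (abs_sub_busemann_le hδ ω p o)] with n hn
  rw [abs_le] at hn
  unfold gromovProduct
  linarith [hδ.1]

end Boundary

/-! ### Orbits of a countable group and their visits to a set -/

noncomputable section CountableAction

variable {Γ Y : Type*} [Group Γ] [MulAction Γ Y]

/-- The union of all translates of a set. -/
def saturation (Γ : Type*) {Y : Type*} [Group Γ] [MulAction Γ Y] (A : Set Y) : Set Y :=
  {y | ∃ g : Γ, g • y ∈ A}

lemma iUnion_smul_eq_saturation (A : Set Y) : ⋃ g : Γ, g • A = saturation Γ A := by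
  ext y
  simp only [mem_iUnion, mem_smul_set_iff_inv_smul_mem, saturation, mem_ofPred_eq]
  exact ⟨fun ⟨g, h⟩ => ⟨g⁻¹, h⟩, fun ⟨g, h⟩ => ⟨g⁻¹, by rwa [inv_inv]⟩⟩

lemma subset_saturation (A : Set Y) : A ⊆ saturation Γ A :=
  fun y hy => ⟨1, by rwa [one_smul]⟩

lemma smul_mem_saturation {A : Set Y} {g : Γ} {y : Y} :
    g • y ∈ saturation Γ A ↔ y ∈ saturation Γ A :=
  ⟨fun ⟨h, hh⟩ => ⟨h * g, by rwa [mul_smul]⟩,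
    fun ⟨h, hh⟩ => ⟨h * g⁻¹, by rwa [mul_smul, inv_smul_smul]⟩⟩

/-- The number of elements of the group which move a given point into `A`. -/
def visitCount (Γ : Type*) {Y : Type*} [Group Γ] [MulAction Γ Y] (A : Set Y) (y : Y) : ℝ≥0∞ :=
  ∑' g : Γ, A.indicator 1 (g • y)

lemma one_le_visitCount {A : Set Y} {g : Γ} {y : Y} (h : g • y ∈ A) : 1 ≤ visitCount Γ A y := by
  refine le_trans ?_ (ENNReal.le_tsum g)
  simp [h]

lemma visitCount_eq_zero {A : Set Y} {y : Y} (h : ∀ g : Γ, g • y ∉ A) :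
    visitCount Γ A y = 0 :=
  ENNReal.tsum_eq_zero.2 fun g => indicator_of_notMem (h g) _

/-- Among the elements of a weighted set, at most `n` have at most `n` elements of greater or
equal weight. -/
lemma tsum_indicator_rank_le {ι : Type*} (φ : ι → ℝ≥0∞) (c : ℝ≥0∞) :
    ∑' k, indicator {k | ∑' l, indicator {l | φ k ≤ φ l} (1 : ι → ℝ≥0∞) l ≤ c} 1 k ≤ c := by
  classical
  set T := {k | ∑' l, indicator {l | φ k ≤ φ l} (1 : ι → ℝ≥0∞) l ≤ c} with hT
  rw [ENNReal.tsum_eq_iSup_sum]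
  refine iSup_le fun s => ?_
  simp only [indicator_apply, Pi.one_apply]
  rw [← Finset.sum_filter]
  rcases (s.filter (· ∈ T)).eq_empty_or_nonempty with h | h
  · simp [h]
  -- All elements of the finite subset weigh at least as much as its lightest element `k`, so their
  -- number is at most the rank of `k`.
  obtain ⟨k, hk, hmin⟩ := Finset.exists_min_image _ φ h
  have hkT : k ∈ T := (Finset.mem_filter.1 hk).2
  refine le_trans ?_ (hkT : ∑' l, indicator {l | φ k ≤ φ l} (1 : ι → ℝ≥0∞) l ≤ c)
  refine le_trans (Finset.sum_le_sum fun l hl => ?_) (ENNReal.sum_le_tsum _)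
  rw [indicator_of_mem (show l ∈ {l | φ k ≤ φ l} from hmin l hl)]
  rfl

variable [MeasurableSpace Y]

lemma isWanderingSet_iff {A : Set Y} :
    IsWanderingSet Γ A ↔ MeasurableSet A ∧ ∀ y ∈ A, ∀ g : Γ, g • y ∈ A → g = 1 := by
  refine and_congr_right fun _ => ⟨fun h y hy g hg => ?_, fun h g k hgk => ?_⟩
  · by_contra hne
    refine disjoint_left.1 (h hne) (smul_mem_smul_set (a := g) hy) ?_
    rwa [one_smul]
  · refine disjoint_left.2 fun y hg hk => hgk ?_
    rw [mem_smul_set_iff_inv_smul_mem] at hg hk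
    have := h _ hg (k⁻¹ * g) (by rwa [mul_smul, smul_inv_smul])
    exact (inv_mul_eq_one.1 this).symm

lemma IsWanderingSet.visitCount_le_one {A : Set Y} (hA : IsWanderingSet Γ A) (y : Y) :
    visitCount Γ A y ≤ 1 := by
  by_cases h : ∃ g : Γ, g • y ∈ A
  · obtain ⟨g, hg⟩ := h
    rw [visitCount, tsum_eq_single g fun k hk => indicator_of_notMem (fun hkA => hk ?_) _]
    · simp [hg]
    · have := (isWanderingSet_iff.1 hA).2 _ hg (k * g⁻¹) (by rwa [mul_smul, inv_smul_smul])
      exact mul_inv_eq_one.1 this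
  · rw [visitCount_eq_zero (not_exists.1 h)]
    exact zero_le_one

lemma IsWanderingSet.smul [MeasurableConstSMul Γ Y] {A : Set Y} (hA : IsWanderingSet Γ A)
    (g : Γ) : IsWanderingSet Γ (g • A) := by
  refine ⟨hA.1.const_smul g, fun h k hhk => ?_⟩
  simp only [smul_smul]
  exact hA.2 fun e => hhk (mul_right_cancel e)

section Measurability

variable [MeasurableConstSMul Γ Y] [Countable Γ]

lemma measurableSet_saturation {A : Set Y} (hA : MeasurableSet A) :
    MeasurableSet (saturation Γ A) := by
  rw [← iUnion_smul_eq_saturation]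
  exact MeasurableSet.iUnion fun g => hA.const_smul g

/-! ### The Hopf decomposition -/

/-- Every measurable action of a countable group has a conservative part. -/
lemma exists_isConservativePart (μ : Measure Y) [IsFiniteMeasure μ] :
    ∃ C, IsConservativePart Γ μ C := by
  -- Exhaustion: wandering sets whose saturations have measures tending to the supremum.
  obtain ⟨u, -, hu, hmem⟩ := exists_seq_tendsto_sSup
    (S := (fun A => μ (saturation Γ A)) '' {A | IsWanderingSet Γ A})
    ⟨_, mem_image_of_mem _ (isWanderingSet_iff.2 ⟨.empty, fun y hy => hy.elim⟩)⟩
    (OrderTop.bddAbove _)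
  choose A hA hAu using hmem
  have hA' := fun n => isWanderingSet_iff.1 (hA n)
  set s := sSup ((fun A => μ (saturation Γ A)) '' {A | IsWanderingSet Γ A}) with hs
  have hs_top : s ≠ ∞ := by
    refine ne_top_of_le_ne_top (measure_ne_top μ univ) (sSup_le ?_)
    rintro _ ⟨B, -, rfl⟩
    exact measure_mono (subset_univ _)
  refine ⟨(⋃ n, saturation Γ (A n))ᶜ, ?_, fun g => ?_, fun B hBC hB => ?_, ?_⟩
  · exact (MeasurableSet.iUnion fun n => measurableSet_saturation (hA n).1).compl
  · ext y
    simp only [mem_smul_set_iff_inv_smul_mem, mem_compl_iff, mem_iUnion, smul_mem_saturation]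
  -- The non-returning points of `B` form a wandering set with saturation disjoint from that of each
  -- `A n`. Adding it to `A n` cannot exceed the supremum, so it is null.
  · set W : Set Y := {y | y ∈ B ∧ ∀ g : Γ, g • y ∈ B → g = 1} with hW
    have hWm : MeasurableSet W := by
      have : W = B ∩ ⋂ g : Γ, ⋂ (_ : g ≠ 1), (fun y => g • y) ⁻¹' Bᶜ := by
        ext y
        simp only [hW, mem_ofPred_eq, mem_inter_iff, mem_iInter, mem_preimage, mem_compl_iff]
        refine and_congr_right fun _ => forall_congr' fun g => ?_
        exact not_imp_not.symm
      rw [this]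
      exact hB.inter (MeasurableSet.iInter fun g => MeasurableSet.iInter fun _ =>
        measurable_const_smul g hB.compl)
    have hdisj : ∀ n, Disjoint (saturation Γ (A n)) (saturation Γ W) := fun n => by
      refine disjoint_left.2 fun y h1 ⟨g, hg⟩ => hBC hg.1 (mem_iUnion.2 ⟨n, ?_⟩)
      exact smul_mem_saturation.2 h1
    have hle : ∀ n, u n + μ (saturation Γ W) ≤ s := fun n => by
      have hw : IsWanderingSet Γ (A n ∪ W) := by
        refine isWanderingSet_iff.2 ⟨(hA n).1.union hWm, ?_⟩
        rintro y (hy | hy) g (hg | hg)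
        · exact (hA' n).2 y hy g hg
        · exact (disjoint_left.1 (hdisj n) (subset_saturation _ hy) ⟨g, hg⟩).elim
        · exact (disjoint_left.1 (hdisj n) ⟨g, hg⟩ (subset_saturation _ hy)).elim
        · exact hy.2 g hg.1
      have hun : saturation Γ (A n ∪ W) = saturation Γ (A n) ∪ saturation Γ W := by
        ext y
        simp only [saturation, mem_union, mem_ofPred_eq, exists_or]
      rw [← hAu n, ← measure_union (hdisj n) (measurableSet_saturation hWm), ← hun]
      exact le_sSup ⟨_, hw, rfl⟩
    have h0 : s + μ (saturation Γ W) ≤ s + 0 := by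
      rw [add_zero]
      exact le_of_tendsto' (hu.add_const _) hle
    have h1 : μ W = 0 := measure_mono_null (subset_saturation (Γ := Γ) W)
      (le_zero_iff.1 ((ENNReal.add_le_add_iff_left hs_top).1 h0))
    filter_upwards [measure_eq_zero_iff_ae_notMem.1 h1] with y hy hyB
    by_contra! hcon
    exact hy ⟨hyB, fun g hg => by_contra fun hne => hcon g hne hg⟩
  -- Removing the saturations of the earlier sets makes the union wandering without changing its
  -- saturation.
  · set B : ℕ → Set Y := fun n => A n ∩ ⋂ m, ⋂ (_ : m < n), (saturation Γ (A m))ᶜ with hB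
    have hB' : ∀ n y, y ∈ B n ↔ y ∈ A n ∧ ∀ m < n, y ∉ saturation Γ (A m) := by simp [hB]
    refine ⟨⋃ n, B n, ?_, isWanderingSet_iff.2 ⟨?_, ?_⟩, ?_⟩
    · rw [compl_compl]
      exact iUnion_mono fun n y hy => subset_saturation _ hy.1
    · exact MeasurableSet.iUnion fun n => (hA n).1.inter <| MeasurableSet.iInter fun m =>
        MeasurableSet.iInter fun _ => (measurableSet_saturation (hA m).1).compl
    · intro y hy g hg
      simp only [mem_iUnion, hB'] at hy hg
      obtain ⟨n, hn, hn'⟩ := hy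
      obtain ⟨m, hm, hm'⟩ := hg
      rcases lt_trichotomy n m with h | rfl | h
      · exact (hm' n h (smul_mem_saturation.2 (subset_saturation _ hn))).elim
      · exact (hA' n).2 y hn g hm
      · exact (hn' m h ⟨g, hm⟩).elim
    · have hU : saturation Γ (⋃ n, B n) = ⋃ n, saturation Γ (A n) := by
        refine Subset.antisymm ?_ ?_
        · rintro y ⟨g, hg⟩
          obtain ⟨n, hn⟩ := mem_iUnion.1 hg
          exact mem_iUnion.2 ⟨n, g, hn.1⟩
        · classical
          intro y hy
          have hy' := mem_iUnion.1 hy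
          obtain ⟨g, hg⟩ := Nat.find_spec hy'
          refine ⟨g, mem_iUnion.2 ⟨Nat.find hy', (hB' _ _).2 ⟨hg, fun m hm h => ?_⟩⟩⟩
          exact Nat.find_min hy' hm (smul_mem_saturation.1 h)
      refine Filter.EventuallyEq.of_eq ?_
      rw [iUnion_smul_eq_saturation, hU]
      exact (compl_compl (⋃ n, saturation Γ (A n))).symm

/-- In the conservative part of an essentially free action, a set of positive measure is visited
an unbounded number of times. -/
lemma measure_eq_zero_of_visitCount_le [MeasurableSpace.CountablySeparated Y] {μ : Measure Y}
    {C : Set Y} (hC : ∀ A ⊆ C, MeasurableSet A → IsRecurrentSet Γ μ A)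
    (hfree : IsEssentiallyFree Γ μ) (n : ℕ) : ∀ A ⊆ C, MeasurableSet A →
      (∀ᵐ y ∂μ, visitCount Γ A y ≤ n) → μ A = 0 := by
  induction n with
  | zero =>
    intro A _ _ h
    refine measure_eq_zero_iff_ae_notMem.2 ?_
    filter_upwards [h] with y hy hyA
    have := (one_le_visitCount (Γ := Γ) (g := 1) (by rwa [one_smul])).trans hy
    simp at this
  | succ n ih =>
    intro A hAC hA h
    -- An orbit meeting this set also visits `A \ U`, which uses up one of its `n + 1` visits to
    -- `A`; the induction hypothesis then applies.
    have key : ∀ U, MeasurableSet U → μ (A ∩ U ∩ saturation Γ (A \ U)) = 0 := by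
      intro U hU
      refine ih _ (fun y hy => hAC hy.1.1)
        ((hA.inter hU).inter (measurableSet_saturation (hA.diff hU))) ?_
      filter_upwards [h] with y hy
      by_cases hex : ∃ g : Γ, g • y ∈ A ∩ U ∩ saturation Γ (A \ U)
      · obtain ⟨g, hg⟩ := hex
        obtain ⟨k, hk⟩ := smul_mem_saturation.1 hg.2
        have h1 := one_le_visitCount hk
        have h2 : visitCount Γ (A ∩ U ∩ saturation Γ (A \ U)) y + visitCount Γ (A \ U) y ≤
            visitCount Γ A y := by
          rw [visitCount, visitCount, ← ENNReal.tsum_add]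
          refine ENNReal.tsum_le_tsum fun g => ?_
          by_cases hgU : g • y ∈ U <;> by_cases hgA : g • y ∈ A <;>
            simp [hgU, hgA]
          exact indicator_le' (fun _ _ => le_rfl) (fun _ _ => zero_le) _
        have h3 : visitCount Γ (A ∩ U ∩ saturation Γ (A \ U)) y + 1 ≤ n + 1 := by
          refine ((add_le_add_right h1 _).trans h2).trans ?_
          exact_mod_cast hy
        exact (ENNReal.add_le_add_iff_right ENNReal.one_ne_top).1 h3
      · rw [visitCount_eq_zero (not_exists.1 hex)]
        exact zero_le
    obtain ⟨S, hSc, hSm, hS⟩ := exists_countable_separating Y MeasurableSet univ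
    refine measure_eq_zero_iff_ae_notMem.2 ?_
    have e1 : ∀ᵐ y ∂μ, ∀ U ∈ S, y ∉ A ∩ U ∩ saturation Γ (A \ U) :=
      (ae_ball_iff hSc).2 fun U hU => measure_eq_zero_iff_ae_notMem.1 (key U (hSm U hU))
    have e2 : ∀ᵐ y ∂μ, ∀ U ∈ S, y ∉ A ∩ Uᶜ ∩ saturation Γ (A \ Uᶜ) :=
      (ae_ball_iff hSc).2 fun U hU => measure_eq_zero_iff_ae_notMem.1 (key Uᶜ (hSm U hU).compl)
    have e3 : ∀ᵐ y ∂μ, ∀ g : Γ, g ≠ 1 → g • y ≠ y :=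
      ae_all_iff.2 fun g => by
        by_cases hg : g = 1
        · exact ae_of_all _ fun _ h => (h hg).elim
        · exact (hfree g hg).mono fun _ h _ => h
    -- A return to `A` cannot be separated from `y` by any `U ∈ S`, so it is `y` itself, against
    -- freeness.
    filter_upwards [e1, e2, e3, hC A hAC hA] with y h1 h2 h3 h4 hyA
    obtain ⟨g, hg, hgA⟩ := h4 hyA
    refine h3 g hg (hS _ (mem_univ _) _ (mem_univ _) fun U hU => ?_)
    by_contra hcon
    by_cases hyU : y ∈ U
    · exact h1 U hU ⟨⟨hyA, hyU⟩, g, hgA, fun hgU => hcon (iff_of_true hgU hyU)⟩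
    · exact h2 U hU ⟨⟨hyA, hyU⟩, g, hgA, fun hgU => hcon (iff_of_false hgU hyU)⟩

end Measurability

/-! ### Orbit densities -/

/-- The Radon–Nikodym derivative of the translate `g μ` with respect to `μ`. -/
def orbitDensity (μ : Measure Y) (g : Γ) (y : Y) : ℝ≥0∞ :=
  (μ.map (g • ·)).rnDeriv μ y

variable {μ : Measure Y}

lemma measurable_orbitDensity (g : Γ) : Measurable (orbitDensity μ g) :=
  Measure.measurable_rnDeriv _ _

/-- The number of elements of the group with orbit density at least `1`. -/
def denseCount (Γ : Type*) {Y : Type*} [Group Γ] [MulAction Γ Y] [MeasurableSpace Y]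
    (μ : Measure Y) (y : Y) : ℝ≥0∞ :=
  ∑' g : Γ, {y | 1 ≤ orbitDensity μ g y}.indicator 1 y

lemma denseCount_le_tsum (y : Y) : denseCount Γ μ y ≤ ∑' g : Γ, orbitDensity μ g y :=
  ENNReal.tsum_le_tsum fun _ => indicator_le' (fun _ h => h) (fun _ _ => zero_le) y

lemma measurable_denseCount [Countable Γ] : Measurable (denseCount Γ μ) :=
  Measurable.tsum fun _ => measurable_one.indicator
    (measurableSet_le measurable_const (Measure.measurable_rnDeriv _ _))

variable [IsFiniteMeasure μ]

lemma ae_orbitDensity_ne_top (g : Γ) : ∀ᵐ y ∂μ, orbitDensity μ g y ≠ ∞ :=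
  Measure.rnDeriv_ne_top _ _

variable [MeasurableConstSMul Γ Y]

lemma ae_orbitDensity_ne_zero (hq : ∀ g : Γ, μ.map (g • ·) ≪ μ) (g : Γ) :
    ∀ᵐ y ∂μ, orbitDensity μ g y ≠ 0 := by
  have hac : μ ≪ μ.map (g • ·) := by
    have h := (hq g⁻¹).map (measurable_const_smul g)
    rw [Measure.map_map (measurable_const_smul g) (measurable_const_smul g⁻¹)] at h
    have hid : ((g • ·) : Y → Y) ∘ (g⁻¹ • ·) = id := funext fun y => smul_inv_smul g y
    rwa [hid, Measure.map_id] at h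
  exact (Measure.rnDeriv_pos' hac).mono fun _ h => h.ne'

/-- Chain rule through g⁻¹μ: the density of g⁻¹hμ with respect to g⁻¹μ at y is that of hμ with
respect to μ at gy. -/
lemma ae_orbitDensity_smul (hq : ∀ g : Γ, μ.map (g • ·) ≪ μ) (g h : Γ) :
    ∀ᵐ y ∂μ, orbitDensity μ h (g • y) * orbitDensity μ g⁻¹ y = orbitDensity μ (g⁻¹ * h) y := by
  have hmap : (μ.map (h • ·)).map (g⁻¹ • ·) = μ.map ((g⁻¹ * h) • ·) := by
    rw [Measure.map_map (measurable_const_smul _) (measurable_const_smul _)]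
    congr 1
    exact funext fun y => (mul_smul _ _ _).symm
  have h1 := (measurableEmbedding_const_smul (α := Y) g⁻¹).rnDeriv_map (μ.map (h • ·)) μ
  have h2 := (Measure.QuasiMeasurePreserving.mk (measurable_const_smul g) (hq g)).ae h1
  have h3 : (μ.map ((g⁻¹ * h) • ·)).rnDeriv (μ.map (g⁻¹ • ·)) * (μ.map (g⁻¹ • ·)).rnDeriv μ
      =ᵐ[μ] (μ.map ((g⁻¹ * h) • ·)).rnDeriv μ := by
    refine Measure.rnDeriv_mul_rnDeriv ?_
    rw [← hmap]
    exact (hq h).map (measurable_const_smul _)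
  filter_upwards [h2, h3] with y h2 h3
  rw [hmap, inv_smul_smul] at h2
  rw [orbitDensity, orbitDensity, orbitDensity, ← h2, ← h3, Pi.mul_apply]

variable [Countable Γ]

/-- Both the integral of ∑ρ_g over `A` and the integral of the visit count equal ∑ μ(g⁻¹A), which is
therefore at most n μ(Y). -/
lemma ae_tsum_orbitDensity_ne_top (hq : ∀ g : Γ, μ.map (g • ·) ≪ μ) {A : Set Y}
    (hA : MeasurableSet A) {n : ℝ≥0∞} (hn : n ≠ ∞) (h : ∀ᵐ y ∂μ, visitCount Γ A y ≤ n) :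
    ∀ᵐ y ∂μ, y ∈ A → ∑' g : Γ, orbitDensity μ g y ≠ ∞ := by
  rw [← ae_restrict_iff' hA]
  have hint : ∫⁻ y in A, ∑' g : Γ, orbitDensity μ g y ∂μ = ∫⁻ y, visitCount Γ A y ∂μ := by
    simp only [visitCount]
    rw [lintegral_tsum fun g => (measurable_orbitDensity g).aemeasurable,
      lintegral_tsum (f := fun (g : Γ) y => A.indicator 1 (g • y)) fun g =>
        ((measurable_one.indicator hA).comp (measurable_const_smul g)).aemeasurable]
    refine tsum_congr fun g => ?_
    rw [← lintegral_map (f := A.indicator 1) (measurable_one.indicator hA)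
      (measurable_const_smul g), lintegral_indicator_one hA]
    exact Measure.setLIntegral_rnDeriv (hq g) A
  refine (ae_lt_top (Measurable.tsum measurable_orbitDensity) ?_).mono fun _ h => h.ne
  rw [hint]
  refine ne_top_of_le_ne_top ?_ (lintegral_mono_ae h)
  rw [lintegral_const]
  exact ENNReal.mul_ne_top hn (measure_ne_top _ _)

/-- By the chain rule, ρ_k(gy) ≥ 1 means that ρ_{g⁻¹k}(y) ≥ ρ_{g⁻¹}(y). So the count at gy is the
rank of g⁻¹ among the densities at y, and `tsum_indicator_rank_le` applies. -/
lemma ae_visitCount_denseCount_le (hq : ∀ g : Γ, μ.map (g • ·) ≪ μ) (n : ℝ≥0∞) :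
    ∀ᵐ y ∂μ, visitCount Γ {y | denseCount Γ μ y ≤ n} y ≤ n := by
  filter_upwards [ae_all_iff.2 fun g => ae_all_iff.2 (ae_orbitDensity_smul hq g),
    ae_all_iff.2 (ae_orbitDensity_ne_zero hq),
    ae_all_iff.2 (ae_orbitDensity_ne_top (Γ := Γ) (μ := μ))] with y h1 h2 h3
  refine le_trans (le_of_eq ?_) (tsum_indicator_rank_le (fun g : Γ => orbitDensity μ g y) n)
  rw [← (Equiv.inv Γ).tsum_eq, visitCount]
  refine tsum_congr fun g => ?_
  have hcount : denseCount Γ μ (g • y) = ∑' k : Γ,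
      indicator {k | orbitDensity μ g⁻¹ y ≤ orbitDensity μ k y} (1 : Γ → ℝ≥0∞) k := by
    rw [← (Equiv.mulLeft g⁻¹).tsum_eq, denseCount]
    refine tsum_congr fun k => ?_
    have : 1 ≤ orbitDensity μ k (g • y) ↔ orbitDensity μ g⁻¹ y ≤ orbitDensity μ (g⁻¹ * k) y := by
      rw [← h1 g k]
      conv_rhs => lhs; rw [← one_mul (orbitDensity μ g⁻¹ y)]
      exact (ENNReal.mul_le_mul_iff_left (h2 _) (h3 _)).symm
    simp only [indicator_apply, mem_ofPred_eq, Equiv.coe_mulLeft, this, Pi.one_apply]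
  simp only [indicator_apply, mem_ofPred_eq, hcount, Equiv.inv_apply, Pi.one_apply]

/-- Almost surely, the sum of orbit densities is infinite if and only if infinitely many of them
are at least `1`. -/
lemma ae_tsum_orbitDensity_eq_top_iff (hq : ∀ g : Γ, μ.map (g • ·) ≪ μ) :
    ∀ᵐ y ∂μ, ∑' g : Γ, orbitDensity μ g y = ∞ ↔ denseCount Γ μ y = ∞ := by
  have h : ∀ n : ℕ, ∀ᵐ y ∂μ, denseCount Γ μ y ≤ n → ∑' g : Γ, orbitDensity μ g y ≠ ∞ :=
    fun n => ae_tsum_orbitDensity_ne_top hq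
      (measurableSet_le measurable_denseCount measurable_const) (ENNReal.natCast_ne_top n)
      (ae_visitCount_denseCount_le hq n)
  filter_upwards [ae_all_iff.2 h] with y hy
  refine ⟨fun h1 => ?_, fun h1 => top_le_iff.1 (h1 ▸ denseCount_le_tsum y)⟩
  by_contra hne
  obtain ⟨n, hn⟩ := ENNReal.exists_nat_gt hne
  exact hy n hn.le h1

/-- The conservative part of an essentially free action is the divergence set of the sum of orbit
densities. -/
lemma IsConservativePart.ae_eq_tsum_orbitDensity_eq_top
    [MeasurableSpace.CountablySeparated Y] {C : Set Y} (hC : IsConservativePart Γ μ C)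
    (hfree : IsEssentiallyFree Γ μ) (hq : ∀ g : Γ, μ.map (g • ·) ≪ μ) :
    {y | ∑' g : Γ, orbitDensity μ g y = ∞} =ᵐ[μ] C := by
  obtain ⟨A, -, hA, hAC⟩ := hC.dissipative
  have h1 : ∀ g : Γ, ∀ᵐ y ∂μ, y ∈ g • A → ∑' g : Γ, orbitDensity μ g y ≠ ∞ := fun g =>
    ae_tsum_orbitDensity_ne_top hq (hA.smul g).1 ENNReal.one_ne_top
      (ae_of_all _ (hA.smul g).visitCount_le_one)
  -- The points of `C` with finite count split into countably many sets of bounded visits, each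
  -- null.
  have h2 : ∀ n : ℕ, ∀ᵐ y ∂μ, y ∉ C ∩ {y | denseCount Γ μ y ≤ n} := fun n =>
    measure_eq_zero_iff_ae_notMem.1 <|
      measure_eq_zero_of_visitCount_le hC.conservative hfree n _ inter_subset_left
        (hC.measurableSet.inter (measurableSet_le measurable_denseCount measurable_const)) <| by
        filter_upwards [ae_visitCount_denseCount_le (μ := μ) hq n] with y hy
        refine le_trans (ENNReal.tsum_le_tsum fun g => ?_) hy
        exact indicator_le_indicator_of_subset inter_subset_right (fun _ => zero_le) _
  filter_upwards [ae_all_iff.2 h1, ae_all_iff.2 h2, hAC.mem_iff] with y h1 h2 h3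
  refine propext ⟨fun hy => ?_, fun hy => ?_⟩
  · by_contra hyC
    obtain ⟨g, hg⟩ := mem_iUnion.1 (h3.2 hyC)
    exact h1 g hg hy
  · by_contra hne
    obtain ⟨n, hn⟩ := ENNReal.exists_nat_gt hne
    exact h2 n ⟨hy, (denseCount_le_tsum y).trans hn.le⟩

end CountableAction

/-! ### Change of measure within its class -/

section EquivalentMeasures

variable {Γ Y : Type*} [Group Γ] [MulAction Γ Y] [MeasurableSpace Y] {μ ν : Measure Y}

lemma IsConservativePart.of_equivalent {C : Set Y} (hC : IsConservativePart Γ μ C) (h : ν ≪ μ) :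
    IsConservativePart Γ ν C where
  measurableSet := hC.measurableSet
  invariant := hC.invariant
  conservative A hAC hA := h.ae_le (hC.conservative A hAC hA)
  dissipative := by
    obtain ⟨A, hAC, hA, hU⟩ := hC.dissipative
    exact ⟨A, hAC, hA, h.ae_eq hU⟩

lemma IsEssentiallyFree.of_absolutelyContinuous (hμ : IsEssentiallyFree Γ μ) (h : ν ≪ μ) :
    IsEssentiallyFree Γ ν :=
  fun g hg => h.ae_le (hμ g hg)

end EquivalentMeasures

/-! ### Horospheric limit points and quasi-conformal streams -/

section Horospheric

variable {X : Type*} [MetricSpace X] [IsGromovHyperbolic X]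

instance GromovBoundary.measurableConstSMul (G : Subgroup (X ≃ᵢ X)) :
    MeasurableConstSMul G (GromovBoundary X) :=
  ⟨fun g => (GromovBoundary.continuous_smul (g : X ≃ᵢ X)).measurable⟩

lemma bigHorosphericLimitSet_subset_poincareBusemannDivergenceSet (G : Subgroup (X ≃ᵢ X))
    {D : ℝ} (hD : 0 < D) (o : X) :
    bigHorosphericLimitSet G o ⊆ poincareBusemannDivergenceSet G D o := by
  obtain ⟨δ, hδ⟩ := exists_isHyperbolicConst X
  rintro ω ⟨p, hp⟩
  by_contra hne
  have hfin := ENNReal.finite_const_le_of_tsum_ne_top hne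
    (ε := ENNReal.ofReal (Real.exp (D * (busemann ω p o - 6 * δ))))
    (ENNReal.ofReal_pos.2 (Real.exp_pos _)).ne'
  refine hp ((hfin.image fun g : G => (g : X ≃ᵢ X) o).subset ?_)
  rintro _ ⟨⟨g, rfl⟩, hg⟩
  refine ⟨g, ENNReal.ofReal_le_ofReal (Real.exp_le_exp.2 (mul_le_mul_of_nonneg_left ?_ hD.le)), rfl⟩
  have hg' : busemann ω p ((g : X ≃ᵢ X) o) ≤ 0 := hg
  linarith [(abs_le.1 (abs_busemann_add_sub_le hδ ω p ((g : X ≃ᵢ X) o) o)).1]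

variable {G : Subgroup (X ≃ᵢ X)}

/-- Up to a bounded error β_ω(go,o) + d(o,go) is 2(go|ω)_o, so a lower bound on β forces every far
orbit point to be close to `ω`. One far orbit point is then close to both `ω` and `ω'`. -/
lemma IsDiscreteIsometryGroup.subsingleton_busemann_bddBelow [ProperSpace X] [Infinite G]
    (hG : IsDiscreteIsometryGroup G) (o : X) :
    {ω : GromovBoundary X | ∃ K : ℝ, ∀ g : G, -K ≤ busemann ω ((g : X ≃ᵢ X) o) o}.Subsingleton := by
  obtain ⟨δ, hδ⟩ := exists_isHyperbolicConst X
  rintro ω ⟨K, hK⟩ ω' ⟨K', hK'⟩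
  refine GromovBoundary.eq_of_lt_bdry (o := o) fun R => ?_
  set S := R + 1 + 2 * δ with hS
  obtain ⟨g, hg⟩ := (hG.finite_dist_le o (2 * S + 4 * δ + 2 + max K K')).exists_notMem
  have hg' : 2 * S + 4 * δ + 2 + max K K' < dist o ((g : X ≃ᵢ X) o) :=
    not_le.1 hg
  have h1 : (S : EReal) < gromovProductPt o ((g : X ≃ᵢ X) o) ω :=
    lt_gromovProductPt_of_busemann hδ (by linarith [hK g, le_max_left K K'])
  have h2 : (S : EReal) < gromovProductPt o ((g : X ≃ᵢ X) o) ω' :=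
    lt_gromovProductPt_of_busemann hδ (by linarith [hK' g, le_max_right K K'])
  refine lt_of_lt_of_le (EReal.coe_lt_coe_iff.2 ?_) (GromovBoundary.le_bdry_of_lt_pt hδ h1 h2)
  linarith

lemma IsDiscreteIsometryGroup.finite_le_busemann [ProperSpace X] (hG : IsDiscreteIsometryGroup G) {o : X}
    {ω : GromovBoundary X} (hω : ω ∉ bigHorosphericLimitSet G o)
    (hunb : ¬ ∃ K : ℝ, ∀ g : G, -K ≤ busemann ω ((g : X ≃ᵢ X) o) o) (K : ℝ) :
    {g : G | -K ≤ busemann ω ((g : X ≃ᵢ X) o) o}.Finite := by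
  obtain ⟨δ, hδ⟩ := exists_isHyperbolicConst X
  push Not at hunb
  -- The `6 * δ` absorbs the quasi-cocycle error, placing every go in question in the horoball
  -- through ko.
  obtain ⟨k, hk⟩ := hunb (K + 6 * δ)
  have hfin : (range (fun g : G => (g : X ≃ᵢ X) o) ∩ horoball ω ((k : X ≃ᵢ X) o)).Finite := by
    by_contra h
    exact hω ⟨_, h⟩
  refine (hfin.preimage' (f := fun g : G => (g : X ≃ᵢ X) o) fun b _ => ?_).subset fun g hg => ?_
  -- Discreteness makes the fibres of the orbit map finite, so finiteness passes from orbit points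
  -- to group elements.
  · refine (hG.finite_dist_le o (dist o b)).subset fun g hg => ?_
    have hg' : (g : X ≃ᵢ X) o = b := hg
    simp [hg']
  · refine ⟨mem_range_self g, ?_⟩
    have hg' : -K ≤ busemann ω ((g : X ≃ᵢ X) o) o := hg
    change busemann ω ((k : X ≃ᵢ X) o) ((g : X ≃ᵢ X) o) ≤ 0
    linarith [(abs_le.1
      (abs_busemann_add_sub_le hδ ω ((k : X ≃ᵢ X) o) ((g : X ≃ᵢ X) o) o)).2]

variable {D : ℝ} {lam : X → Measure (GromovBoundary X)}

lemma IsInvariantStream.orbitDensity_eq (hinv : IsInvariantStream G lam) (o : X) (g : G) :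
    orbitDensity (lam o) g = (lam ((g : X ≃ᵢ X) o)).rnDeriv (lam o) := by
  rw [hinv]
  rfl

lemma ofReal_exp_le_mul {a b C : ℝ} (h : a ≤ C + b) :
    ENNReal.ofReal (Real.exp a) ≤
      ENNReal.ofReal (Real.exp C) * ENNReal.ofReal (Real.exp b) := by
  rw [← ENNReal.ofReal_mul (Real.exp_pos _).le, ← Real.exp_add]
  exact ENNReal.ofReal_le_ofReal (Real.exp_le_exp.2 h)

/-- Almost surely, the orbit densities are `exp (D β_ω(go, o))` up to a bounded factor. -/
lemma IsQuasiConformalStream.exists_ae_orbitDensity (hlam : IsQuasiConformalStream D lam)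
    (hinv : IsInvariantStream G lam) [Countable G] (o : X) :
    ∃ C : ℝ, ∀ᵐ ω ∂(lam o), ∀ g : G, ∃ a : ℝ, |a - D * busemann ω ((g : X ≃ᵢ X) o) o| ≤ C ∧
      orbitDensity (lam o) g ω = ENNReal.ofReal (Real.exp a) := by
  obtain ⟨C, -, hC⟩ := hlam.quasiconformal
  have := hlam.finite o
  refine ⟨C, ae_all_iff.2 fun g => ?_⟩
  have := hlam.finite ((g : X ≃ᵢ X) o)
  filter_upwards [hC ((g : X ≃ᵢ X) o) o, Measure.rnDeriv_ne_top (lam ((g : X ≃ᵢ X) o)) (lam o),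
    Measure.rnDeriv_pos' (hlam.equivalent o ((g : X ≃ᵢ X) o))] with ω h1 h2 h3
  refine ⟨_, h1, ?_⟩
  rw [Real.exp_log (ENNReal.toReal_pos h3.ne' h2), ENNReal.ofReal_toReal h2,
    hinv.orbitDensity_eq]

lemma ae_poincareBusemannDivergenceSet_eq (hlam : IsQuasiConformalStream D lam)
    (hinv : IsInvariantStream G lam) [Countable G] (o : X) :
    poincareBusemannDivergenceSet G D o =ᵐ[lam o]
      {ω | ∑' g : G, orbitDensity (lam o) g ω = ∞} := by
  obtain ⟨C, hC⟩ := hlam.exists_ae_orbitDensity hinv o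
  filter_upwards [hC] with ω hω
  have top_of_le : ∀ f h : G → ℝ≥0∞, (∀ g, f g ≤ ENNReal.ofReal (Real.exp C) * h g) →
      ∑' g, f g = ∞ → ∑' g, h g = ∞ := by
    intro f h hle hf
    by_contra hne
    refine ENNReal.mul_ne_top (ENNReal.ofReal_ne_top (r := Real.exp C)) hne ?_
    rw [← ENNReal.tsum_mul_left, ← top_le_iff, ← hf]
    exact ENNReal.tsum_le_tsum hle
  refine propext ⟨top_of_le _ _ fun g => ?_, top_of_le _ _ fun g => ?_⟩ <;>
    obtain ⟨a, ha, hg⟩ := hω g <;> rw [hg] <;> refine ofReal_exp_le_mul ?_ <;>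
    linarith [(abs_le.1 ha).1, (abs_le.1 ha).2]

theorem bigHorosphericLimitSet_ae_eq [ProperSpace X] (hG : IsDiscreteIsometryGroup G)
    (hlam : IsQuasiConformalStream D lam) (hinv : IsInvariantStream G lam)
    (hatom : ∀ x, NullSingletonClass (lam x)) (o : X) :
    bigHorosphericLimitSet G o =ᵐ[lam o] poincareBusemannDivergenceSet G D o := by
  have := hG.countable o
  have := hlam.finite o
  have := hatom o
  have hq : ∀ g : G, (lam o).map (g • ·) ≪ lam o := fun g => hinv g o ▸ hlam.equivalent _ _
  -- The only use of non-atomicity: for infinite `G` the exceptional set has at most one point.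
  have hexc : ∀ᵐ ω ∂(lam o), Infinite G →
      ¬ ∃ K : ℝ, ∀ g : G, -K ≤ busemann ω ((g : X ≃ᵢ X) o) o := by
    rcases finite_or_infinite G with hfin | hinf
    · exact ae_of_all _ fun ω h => (not_finite G).elim
    · refine (measure_eq_zero_iff_ae_notMem.1
        ((hG.subsingleton_busemann_bddBelow o).measure_zero (lam o))).mono fun ω h _ => h
  obtain ⟨C, hC⟩ := hlam.exists_ae_orbitDensity hinv o
  filter_upwards [hC, hexc, ae_tsum_orbitDensity_eq_top_iff hq,
    (ae_poincareBusemannDivergenceSet_eq hlam hinv o).mem_iff] with ω h1 h2 h3 h4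
  refine propext ⟨fun h =>
    bigHorosphericLimitSet_subset_poincareBusemannDivergenceSet G hlam.dim_pos o h, fun h => ?_⟩
  by_contra hω
  have hfin : {g : G | 1 ≤ orbitDensity (lam o) g ω}.Finite := by
    rcases finite_or_infinite G with hf | hinf
    · exact toFinite _
    -- Density at least 1 means a nonnegative logarithm, hence D β ≥ -C.
    refine (hG.finite_le_busemann hω (h2 hinf) (C / D)).subset fun g hg => ?_
    obtain ⟨a, ha, hga⟩ := h1 g
    have h5 : (1 : ℝ≥0∞) ≤ orbitDensity (lam o) g ω := hg
    rw [hga, ENNReal.one_le_ofReal, Real.one_le_exp_iff] at h5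
    have h6 : -C ≤ busemann ω ((g : X ≃ᵢ X) o) o * D := by
      linarith [(abs_le.1 ha).2]
    change -(C / D) ≤ _
    rwa [← neg_div, div_le_iff₀ hlam.dim_pos]
  refine absurd (h3.1 (h4.1 h)) ?_
  rw [denseCount, tsum_eq_sum (s := hfin.toFinset) fun g hg =>
    indicator_of_notMem (s := {y | 1 ≤ orbitDensity (lam o) g y})
      (fun h => hg (hfin.mem_toFinset.2 h)) _]
  refine (ENNReal.sum_lt_top.2 fun g _ => ?_).ne
  exact (indicator_le_self' (fun _ _ => zero_le) ω).trans_lt ENNReal.one_lt_top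

end Horospheric

theorem mainTheorem5 {X : Type*} [MetricSpace X] [ProperSpace X] [NoncompactSpace X]
    [IsGromovHyperbolic X] (G : Subgroup (X ≃ᵢ X)) (hG : IsDiscreteIsometryGroup G)
    (D : ℝ) (lam : X → Measure (GromovBoundary X)) (hlam : IsQuasiConformalStream D lam)
    (hinv : IsInvariantStream G lam) (hatom : ∀ x, NullSingletonClass (lam x)) (o x : X) :
    bigHorosphericLimitSet G o =ᵐ[lam x] poincareBusemannDivergenceSet G D o ∧
    (IsEssentiallyFree G (lam x) →
      (∃ C, IsConservativePart G (lam x) C) ∧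
      ∀ C, IsConservativePart G (lam x) C →
        bigHorosphericLimitSet G o =ᵐ[lam x] C ∧
        poincareBusemannDivergenceSet G D o =ᵐ[lam x] C) := by
  have := hG.countable o
  have := hlam.finite o
  have := hlam.finite x
  have h1 : bigHorosphericLimitSet G o =ᵐ[lam x] poincareBusemannDivergenceSet G D o :=
    (hlam.equivalent x o).ae_eq (bigHorosphericLimitSet_ae_eq hG hlam hinv hatom o)
  refine ⟨h1, fun hfree => ⟨exists_isConservativePart (lam x), fun C hC => ?_⟩⟩
  have hq : ∀ g : G, (lam o).map (g • ·) ≪ lam o := fun g => hinv g o ▸ hlam.equivalent _ _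
  -- The orbit densities are those of `lam o`; the decomposition and freeness are carried over from
  -- `lam x` by equivalence, and the conclusion is carried back.
  have h2 : poincareBusemannDivergenceSet G D o =ᵐ[lam x] C :=
    (hlam.equivalent x o).ae_eq <| (ae_poincareBusemannDivergenceSet_eq hlam hinv o).trans <|
      (hC.of_equivalent (hlam.equivalent o x)).ae_eq_tsum_orbitDensity_eq_top
        (hfree.of_absolutelyContinuous (hlam.equivalent o x)) hq
  exact ⟨h1.trans h2, h2⟩
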